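/- Let $q\ge 2$, $s\ge 0$ and $n\ge 1$ be integers and $\Sigma_q=\{0,1,\dots,q-1\}$. For $x=(x_1,\dots,x_n)\in\Sigma_q^n$ put $x_0=0$, let $d(x)_i\in\{0,\dots,q-1\}$ be the residue of $x_i-x_{i-1}$ modulo $q$, and let $g(x)_i=\sum_{j=1}^{i} d(x)_j\in\mathbb Z$ for $1\le i\le n$ (the accumulative differential sequence). For $z\in\mathbb Z^n$ and $k\ge 0$ let $\mathrm{VT}^k(z)=\sum_{i=1}^n i^k z_i$. For $0\le k\le 2s$ let $n_k=q(2s+1)\sum_{i=1}^n i^k-2s-1$, let $a_k\in\{0,1,\dots,n_k\}$, and define $$\mathcal C=\bigl\{x\in\Sigma_q^n:\ \mathrm{VT}^k(g(x))\equiv a_k \pmod{n_k+1}\ \text{ for all } 0\le k\le 2s\bigr\}.$$ A code $\mathcal C\subseteq\Sigma_q^n$ is called $t$-deletion $s'$-substitution correcting if no sequence can be obtained from two distinct codewords, from each by $t$ deletions and $s'$ substitutions (where a substitution may leave the symbol unchanged). The redundancy of a nonempty code is $n\log_2 q-\log_2|\mathcal C|$. Then: 1. There is a constant $K$ depending only on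 $q$ and $s$ such that for every $n\ge 1$ there is a choice of $a_0,\dots,a_{2s}$ for which $\mathcal C$ is nonempty and has redundancy at most $(s+1)(2s+1)\log_2 n+K$. 2. For all $q\ge 2$, $s\ge 0$, $n\ge 1$ and every choice of $a_0,\dots,a_{2s}$, $\mathcal C$ is a single-deletion $s$-substitution correcting code. 3. If $q=2$ and $s\ge 1$, then for every $n\ge 1$ and every choice of $a_0,\dots,a_{2s}$, $\mathcal C$ is also a two-deletion $(s-1)$-substitution correcting code. -/

import Mathlib

namespace DelSub

/-- `Errors t s u v`: the sequence `v` can be obtained from the sequence `u` by `t` deletions and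
`s` substitutions, performed one after the other in any order. A substitution may be trivial,
i.e. it may replace a symbol by itself. -/
inductive Errors {α : Type*} : ℕ → ℕ → List α → List α → Prop
  | refl (u : List α) : Errors 0 0 u u
  | deletion {t s : ℕ} {u v : List α} (h : Errors t s u v) (i : ℕ) (hi : i < v.length) :
      Errors (t + 1) s u (v.eraseIdx i)
  | substitution {t s : ℕ} {u v : List α} (h : Errors t s u v) (i : ℕ) (hi : i < v.length)
      (b : α) : Errors t (s + 1) u (v.set i b)

/-- The `t`-deletion `s`-substitution ball of a sequence of length `n` over `α`. -/
def ball {α : Type*} {n : ℕ} (t s : ℕ) (x : Fin n → α) : Set (List α) :=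
  {v | Errors t s (List.ofFn x) v}

/-- A `t`-deletion `s`-substitution correcting code: the balls centered at any two distinct
codewords are disjoint. -/
def IsCorrecting {α : Type*} {n : ℕ} (t s : ℕ) (C : Set (Fin n → α)) : Prop :=
  ∀ x ∈ C, ∀ y ∈ C, x ≠ y → Disjoint (ball t s x) (ball t s y)

/-- The redundancy `n log₂ q - log₂ |C|` of a code `C` of length `n` over the `q`-ary alphabet
`{0, …, q - 1}`. It is meaningful for nonempty `C`. -/
noncomputable def redundancy {q n : ℕ} (C : Set (Fin n → Fin q)) : ℝ :=
  (n : ℝ) * Real.logb 2 (q : ℝ) - Real.logb 2 (C.ncard : ℝ)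

/-- The symbol preceding position `i`, as an integer, and `0` at the first position. -/
def prev {q n : ℕ} (x : Fin n → Fin q) (i : Fin n) : ℤ :=
  if (i : ℕ) = 0 then 0
  else ((x ⟨(i : ℕ) - 1, lt_of_le_of_lt (Nat.sub_le _ _) i.isLt⟩ : ℕ) : ℤ)

/-- The differential sequence: the residue in `{0, …, q - 1}` of the difference between a symbol
and the preceding one. -/
def diff {q n : ℕ} (x : Fin n → Fin q) (i : Fin n) : ℤ :=
  (((x i : ℕ) : ℤ) - prev x i) % (q : ℤ)

/-- The accumulative differential sequence: the (integer) partial sums of the differential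
sequence. -/
def accDiff {q n : ℕ} (x : Fin n → Fin q) (i : Fin n) : ℤ :=
  ∑ j ∈ Finset.Iic i, diff x j

/-- The `k`-th order VT syndrome `∑ i^k z_i`, with positions counted from `1` to `n`. -/
def VT {n : ℕ} (k : ℕ) (z : Fin n → ℤ) : ℤ :=
  ∑ i : Fin n, ((i : ℤ) + 1) ^ k * z i

/-- The largest residue `n_k = q (2s + 1) ∑_{i=1}^n i^k - 2s - 1`. -/
def maxRes (q s n k : ℕ) : ℤ :=
  (q : ℤ) * (2 * (s : ℤ) + 1) * (∑ i ∈ Finset.Icc 1 n, (i : ℤ) ^ k) - 2 * (s : ℤ) - 1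

/-- The parameters `(a_0, …, a_{2s})` are admissible when `a_k ∈ [0, n_k]` for all `k`. -/
def Admissible (q s n : ℕ) (a : Fin (2 * s + 1) → ℤ) : Prop :=
  ∀ k : Fin (2 * s + 1), a k ∈ Set.Icc 0 (maxRes q s n k)

/-- The code of all `x ∈ Σ_q^n` whose accumulative differential sequence has `k`-th order VT
syndrome congruent to `a_k` modulo `n_k + 1`, for every `k ∈ [0, 2s]`. -/
def code (q s n : ℕ) (a : Fin (2 * s + 1) → ℤ) : Set (Fin n → Fin q) :=
  {x | ∀ k : Fin (2 * s + 1), VT k (accDiff x) ≡ a k [ZMOD (maxRes q s n k + 1)]}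

end DelSub

/-!
Write `g x` for the accumulative differential sequence: the least nondecreasing integer sequence
starting from `0` that reduces to `x` modulo `q`; its steps lie in `[0, q - 1]`. If two codewords `x`
and `y` can be turned into a common word, the sequence `δ = g x - g y` has two properties.

* It is small: a deletion or a substitution moves `g` by at most `q`, and a deletion only downwards
  (`Errors.accFrom_take`), so `|δ| ≤ q (2s + 1)`. The first entry is even smaller than `q`, and
  therefore every moment `∑ i ^ k δ_i` is less than the modulus `n_k + 1` (`abs_moment_lt`). Being
  divisible by it, the moment vanishes.
* It changes sign at most `2s` times: along a run of surviving symbols that agree, the values of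
  `g x` and `g y` at the aligned positions are congruent modulo `q`, while the steps of `g` are
  less than `q`. This forces a constant (weak) sign (`mul_nonneg_of_aligned`), so for one deletion a
  sign change costs a substitution. For two deletions and `q = 2` the same holds up to two extra
  sign changes (`exists_cuts_of_two_deletions`), which are paid for by the two substitutions, one on
  each side, that are given up.

A sequence with at most `2s` sign changes agrees in sign with a polynomial of degree at most
`2s`, and pairing the two gives a sum of nonnegative terms that is a combination of the vanishing
moments. Hence `δ = 0` (`eq_zero_of_moments`) and `x = y`. The bound on the redundancy is the
pigeonhole principle: there are `∏ (n_k + 1) ≤ (q (2s + 1)) ^ (2s + 1) n ^ ((s + 1) (2s + 1))` codes,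
and they partition all words (`exists_large_code`).
-/

namespace DelSub

/-! ### The accumulative differential sequence of a list -/

/-- The last entry of the accumulative differential sequence of the list `l`, when the symbol
preceding `l` is `p`; it is `0` for the empty list. The accumulative differential sequence itself
is read off on the prefixes `l.take (i + 1)`. -/
def accFrom {q : ℕ} : ℤ → List (Fin q) → ℤ
  | _, [] => 0
  | p, a :: l => (((a : ℕ) : ℤ) - p) % (q : ℤ) + accFrom ((a : ℕ) : ℤ) l

theorem emod_sub_triangle {q : ℤ} (hq : 0 < q) (p a b : ℤ) :
    (b - p) % q ≤ (a - p) % q + (b - a) % q ∧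
      (a - p) % q + (b - a) % q ≤ (b - p) % q + q := by
  have h1 := Int.emod_nonneg (a - p) hq.ne'
  have h2 := Int.emod_lt_of_pos (a - p) hq
  have h3 := Int.emod_nonneg (b - a) hq.ne'
  have h4 := Int.emod_lt_of_pos (b - a) hq
  have h5 := Int.emod_nonneg (b - p) hq.ne'
  have h6 := Int.emod_lt_of_pos (b - p) hq
  have e : ((a - p) % q + (b - a) % q) % q = (b - p) % q := by
    rw [← Int.add_emod]; congr 1; ring
  rw [← e]
  have h7 : 0 ≤ (a - p) % q + (b - a) % q := by omega
  have h8 : (a - p) % q + (b - a) % q < 2 * q := by omega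
  generalize (a - p) % q + (b - a) % q = u at h7 h8 ⊢
  have hu := Int.emod_add_mul_ediv u q
  have h9 : 0 ≤ u / q := Int.ediv_nonneg h7 hq.le
  have h10 : u / q ≤ 1 := Int.lt_add_one_iff.mp (Int.ediv_lt_of_lt_mul hq h8)
  constructor <;> nlinarith

theorem accFrom_take_eraseIdx {q : ℕ} (hq : 0 < q) (l : List (Fin q)) (p : ℤ) (i k : ℕ) :
    accFrom p ((l.eraseIdx i).take k) ≤ accFrom p (l.take (k + 1)) ∧
      accFrom p (l.take (k + 1)) ≤ accFrom p ((l.eraseIdx i).take k) + q := by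
  have hq' : (0 : ℤ) < q := by exact_mod_cast hq
  induction l generalizing p i k with
  | nil => simp [accFrom]
  | cons a l ih =>
    have h1 := Int.emod_nonneg (((a : ℕ) : ℤ) - p) hq'.ne'
    have h2 := Int.emod_lt_of_pos (((a : ℕ) : ℤ) - p) hq'
    cases i with
    | zero =>
      simp only [List.eraseIdx_cons_zero, List.take_succ_cons, accFrom]
      cases h : l.take k with
      | nil => simp only [accFrom]; omega
      | cons b m =>
        have := emod_sub_triangle hq' p ((a : ℕ) : ℤ) ((b : ℕ) : ℤ)
        simp only [accFrom]; omega
    | succ i =>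
      cases k with
      | zero => simp only [List.take_zero, List.take_succ_cons, accFrom]; omega
      | succ k =>
        have := ih ((a : ℕ) : ℤ) i k
        simp only [List.eraseIdx_cons_succ, List.take_succ_cons, accFrom] at this ⊢
        omega

theorem accFrom_set {q : ℕ} (hq : 0 < q) (l : List (Fin q)) (p : ℤ) (i : ℕ) (b : Fin q) :
    accFrom p l ≤ accFrom p (l.set i b) + q ∧ accFrom p (l.set i b) ≤ accFrom p l + q := by
  have hq' : (0 : ℤ) < q := by exact_mod_cast hq
  induction l generalizing p i with
  | nil => simp [accFrom]
  | cons a l ih =>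
    cases i with
    | zero =>
      have h1 := Int.emod_nonneg (((a : ℕ) : ℤ) - p) hq'.ne'
      have h2 := Int.emod_lt_of_pos (((a : ℕ) : ℤ) - p) hq'
      have h3 := Int.emod_nonneg (((b : ℕ) : ℤ) - p) hq'.ne'
      have h4 := Int.emod_lt_of_pos (((b : ℕ) : ℤ) - p) hq'
      cases l with
      | nil => simp only [List.set_cons_zero, accFrom]; omega
      | cons c m =>
        have h5 := emod_sub_triangle hq' p ((a : ℕ) : ℤ) ((c : ℕ) : ℤ)
        have h6 := emod_sub_triangle hq' p ((b : ℕ) : ℤ) ((c : ℕ) : ℤ)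
        simp only [List.set_cons_zero, accFrom]; omega
    | succ i =>
      have := ih ((a : ℕ) : ℤ) i
      simp only [List.set_cons_succ, accFrom] at this ⊢
      omega

theorem accFrom_take_succ {q : ℕ} (hq : 0 < q) (l : List (Fin q)) (p : ℤ) (k : ℕ) :
    accFrom p (l.take k) ≤ accFrom p (l.take (k + 1)) ∧
      accFrom p (l.take (k + 1)) < accFrom p (l.take k) + q := by
  have hq' : (0 : ℤ) < q := by exact_mod_cast hq
  induction l generalizing p k with
  | nil => simpa [accFrom] using hq
  | cons a l ih =>
    cases k with
    | zero =>
      have h1 := Int.emod_nonneg (((a : ℕ) : ℤ) - p) hq'.ne'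
      have h2 := Int.emod_lt_of_pos (((a : ℕ) : ℤ) - p) hq'
      simp only [List.take_zero, List.take_succ_cons, accFrom]; omega
    | succ k =>
      have := ih ((a : ℕ) : ℤ) k
      simp only [List.take_succ_cons, accFrom] at this ⊢
      omega

theorem dvd_accFrom_take_sub {q : ℕ} {l : List (Fin q)} {k : ℕ} {c : Fin q}
    (h : l[k]? = some c) (p : ℤ) :
    (q : ℤ) ∣ p + accFrom p (l.take (k + 1)) - ((c : ℕ) : ℤ) := by
  induction l generalizing p k with
  | nil => simp at h
  | cons a l ih =>
    have h1 := Int.emod_add_mul_ediv (((a : ℕ) : ℤ) - p) q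
    cases k with
    | zero =>
      obtain rfl : a = c := by simpa using h
      simp only [List.take_zero, List.take_succ_cons, accFrom]
      exact ⟨-((((a : ℕ) : ℤ) - p) / q), by linarith⟩
    | succ k =>
      have h2 := ih (by simpa using h) ((a : ℕ) : ℤ)
      simp only [List.take_succ_cons, accFrom] at h2 ⊢
      obtain ⟨m, hm⟩ := h2
      exact ⟨m - ((((a : ℕ) : ℤ) - p) / q), by linarith⟩

/-- The accumulative differential sequence of a word, extended to all `i : ℕ`. -/
def accSeq {q n : ℕ} (x : Fin n → Fin q) (i : ℕ) : ℤ :=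
  accFrom 0 ((List.ofFn x).take (i + 1))

theorem dvd_accSeq_sub {q n : ℕ} (x : Fin n → Fin q) (i : Fin n) :
    (q : ℤ) ∣ accSeq x i - ((x i : ℕ) : ℤ) := by
  have := dvd_accFrom_take_sub (l := List.ofFn x) (k := i) (c := x i) (by simp) 0
  simpa [accSeq] using this

theorem accSeq_step {q n : ℕ} (hq : 0 < q) (x : Fin n → Fin q) (i : ℕ) :
    accSeq x i ≤ accSeq x (i + 1) ∧ accSeq x (i + 1) < accSeq x i + q :=
  accFrom_take_succ hq _ _ _

theorem accSeq_zero {q n : ℕ} (hq : 0 < q) (x : Fin n → Fin q) :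
    0 ≤ accSeq x 0 ∧ accSeq x 0 < q := by
  simpa [accFrom, accSeq] using accFrom_take_succ hq (List.ofFn x) 0 0

theorem accDiff_eq_accSeq {q n : ℕ} (hq : 0 < q) (x : Fin n → Fin q) (i : Fin n) :
    accDiff x i = accSeq x i := by
  have hq' : (0 : ℤ) < q := by exact_mod_cast hq
  obtain ⟨i, hi⟩ := i
  induction i with
  | zero =>
    have h1 : Finset.Iic (⟨0, hi⟩ : Fin n) = {⟨0, hi⟩} := by
      ext j; simp [Fin.le_def, Fin.ext_iff]
    obtain ⟨h2, h3⟩ := accSeq_zero hq x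
    have h4 : ((x ⟨0, hi⟩ : ℕ) : ℤ) % q = accSeq x 0 % q :=
      Int.modEq_iff_dvd.mpr (dvd_accSeq_sub x ⟨0, hi⟩)
    rw [Int.emod_eq_of_lt h2 h3] at h4
    simp [accDiff, h1, diff, prev, h4]
  | succ i ih =>
    have hi' : i < n := by omega
    have h1 : Finset.Iic (⟨i + 1, hi⟩ : Fin n) = insert ⟨i + 1, hi⟩ (Finset.Iic ⟨i, hi'⟩) := by
      ext j; simp only [Finset.mem_Iic, Finset.mem_insert, Fin.le_def, Fin.ext_iff]; omega
    have h2 := accSeq_step hq x i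
    have h3 : diff x ⟨i + 1, hi⟩ = (accSeq x (i + 1) - accSeq x i) % q := by
      have a1 := dvd_accSeq_sub x ⟨i + 1, hi⟩
      have a2 := dvd_accSeq_sub x ⟨i, hi'⟩
      simp only [diff, prev, Nat.add_sub_cancel, Nat.add_eq_zero_iff, one_ne_zero, and_false,
        if_false]
      apply Int.ModEq.symm
      exact (Int.ModEq.symm (Int.modEq_iff_dvd.mpr a1)).sub
        (Int.ModEq.symm (Int.modEq_iff_dvd.mpr a2)) |>.trans (by rfl)
    rw [Int.emod_eq_of_lt (by omega) (by omega)] at h3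
    have := ih hi'
    rw [accDiff] at this ⊢
    rw [h1, Finset.sum_insert (by simp [Fin.le_def]), this, h3]
    simp

/-! ### The effect of errors -/

/-- Errors change the accumulative differential sequence by a bounded amount. The entry at the end
of a prefix of length `k` is compared with the one at the end of the prefix of length `k - t`; a
deletion can only lower this value, by at most `q`, and a substitution moves it by at most `q`. -/
theorem Errors.accFrom_take {q : ℕ} (hq : 0 < q) {t s : ℕ} {u v : List (Fin q)}
    (h : Errors t s u v) (k : ℕ) :
    accFrom 0 (v.take (k - t)) ≤ accFrom 0 (u.take k) + q * s ∧
      accFrom 0 (u.take k) ≤ accFrom 0 (v.take (k - t)) + q * (s + t) := by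
  induction h with
  | refl u => simp
  | @deletion t s u v h i hi ih =>
    obtain ⟨m, hm⟩ | hkt : (∃ m, k - t = m + 1) ∨ k - t = 0 := by
      rcases Nat.eq_zero_or_pos (k - t) with h | h
      · exact Or.inr h
      · exact Or.inl ⟨k - t - 1, by omega⟩
    · have := accFrom_take_eraseIdx hq v 0 i m
      rw [hm] at ih
      rw [show k - (t + 1) = m by omega]
      push_cast
      constructor <;> nlinarith
    · rw [hkt] at ih
      rw [show k - (t + 1) = 0 by omega]
      simp only [List.take_zero] at ih ⊢
      push_cast
      constructor <;> nlinarith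
  | @substitution t s u v h i hi b ih =>
    have := accFrom_set hq (v.take (k - t)) 0 i b
    rw [List.take_set]
    push_cast
    constructor <;> nlinarith

theorem Errors.length {α : Type*} {t s : ℕ} {u v : List α} (h : Errors t s u v) :
    v.length + t = u.length := by
  induction h with
  | refl u => simp
  | deletion h i hi ih => rw [List.length_eraseIdx_of_lt hi]; omega
  | substitution h i hi b ih => simpa using ih

/-- The symbols that survive `t` deletions and `s` substitutions are aligned with the original
sequence: up to a set `M` of at most `s` positions, the `k`-th symbol comes from position `k + α k`,
where `α k` counts the deletions in front of it. -/
theorem Errors.exists_alignment {α : Type*} {t s : ℕ} {u v : List α} (h : Errors t s u v) :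
    ∃ (α : ℕ → ℕ) (M : Finset ℕ), Monotone α ∧ (∀ k, α k ≤ t) ∧ M.card ≤ s ∧
      ∀ k < v.length, k ∉ M → v[k]? = u[k + α k]? := by
  induction h with
  | refl u => exact ⟨fun _ => 0, ∅, monotone_const, by simp, by simp, by simp⟩
  | @deletion t s u v h i hi ih =>
    obtain ⟨α, M, hmono, hle, hcard, hM⟩ := ih
    refine ⟨fun k => if k < i then α k else α (k + 1) + 1,
      M.image fun m => if m < i then m else m - 1, ?_, ?_, Finset.card_image_le.trans hcard, ?_⟩
    · refine monotone_nat_of_le_succ fun k => ?_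
      have h1 : α k ≤ α (k + 1) := hmono (by omega)
      have h2 : α (k + 1) ≤ α (k + 1 + 1) := hmono (by omega)
      split_ifs <;> omega
    · intro k
      have h1 := hle k
      have h2 := hle (k + 1)
      dsimp only
      split_ifs <;> omega
    · intro k hk hkM
      rw [List.length_eraseIdx_of_lt hi] at hk
      simp only [Finset.mem_image, not_exists, not_and] at hkM
      rw [List.getElem?_eraseIdx]
      beta_reduce
      split_ifs with hki
      · exact hM k (by omega) fun hm => hkM k hm (by simp [hki])
      · rw [hM (k + 1) (by omega) fun hm => hkM (k + 1) hm (by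
          rw [if_neg (by omega)]; omega)]
        congr 1; omega
  | @substitution t s u v h i hi b ih =>
    obtain ⟨α, M, hmono, hle, hcard, hM⟩ := ih
    refine ⟨α, insert i M, hmono, hle, (Finset.card_insert_le _ _).trans (by omega), ?_⟩
    intro k hk hkM
    simp only [Finset.mem_insert, not_or] at hkM
    rw [List.getElem?_set_ne (Ne.symm hkM.1)]
    exact hM k (by simpa using hk) hkM.2

/-! ### Sign changes between aligned sequences -/

theorem nonneg_of_dvd_of_neg_lt {q z : ℤ} (h : q ∣ z) (hz : -q < z) : 0 ≤ z := by
  obtain ⟨m, rfl⟩ := h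
  by_contra! hneg
  rcases lt_trichotomy m 0 with hm | rfl | hm
  · nlinarith
  · simp at hneg
  · nlinarith

theorem le_of_dvd_of_pos {q z : ℤ} (h : q ∣ z) (hz : 0 < z) : q ≤ z := Int.le_of_dvd hz h

theorem sub_mul_sub_nonneg {a b c d : ℤ} (h₁ : b < a → d ≤ c) (h₂ : a < b → c ≤ d) :
    0 ≤ (a - b) * (c - d) := by
  rcases lt_trichotomy a b with h | rfl | h
  · exact mul_nonneg_of_nonpos_of_nonpos (by linarith) (by linarith [h₂ h])
  · simp
  · exact mul_nonneg (by linarith) (by linarith [h₁ h])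

/-- The sign of `g - h` cannot change along a run of aligned symbols when at most one symbol is
deleted from each side. -/
theorem le_of_lt_of_aligned {q : ℤ} {g h : ℕ → ℤ} {α β : ℕ → ℕ}
    (hg : ∀ k, g k ≤ g (k + 1) ∧ g (k + 1) < g k + q)
    (hh : ∀ k, h k ≤ h (k + 1) ∧ h (k + 1) < h k + q)
    (hα : Monotone α) (hβ : Monotone β) (hα1 : ∀ k, α k ≤ 1) (hβ1 : ∀ k, β k ≤ 1)
    {a b : ℕ} (hab : a ≤ b) (hm : ∀ k, a ≤ k → k < b → q ∣ g (k + α k) - h (k + β k))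
    (ha : h a < g a) : h b ≤ g b := by
  -- Strict positivity survives until a symbol of the second sequence has been deleted; from then
  -- on weak positivity survives, supported by `h (k + 1) ≤ g k` while the shift lasts.
  have key : ∀ b, a ≤ b → (∀ k, a ≤ k → k < b → q ∣ g (k + α k) - h (k + β k)) →
      h b < g b ∨ ∃ k, b = k + 1 ∧ β k = 1 ∧ h b ≤ g b ∧ (α k = 0 → h (k + 1) ≤ g k) := by
    intro b hab
    induction b, hab using Nat.le_induction with
    | base => exact fun _ => Or.inl ha
    | succ b hab ih =>
      intro hm
      have hb := hm b hab (Nat.lt_succ_self b)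
      have hgb := hg b
      have hhb := hh b
      have := hα1 b
      have := hβ1 b
      rcases ih fun k h1 h2 => hm k h1 (by omega) with hlt | ⟨k, rfl, hk1, hk2, hk3⟩
      · rcases (show α b = 0 ∨ α b = 1 by omega) with h1 | h1 <;>
        rcases (show β b = 0 ∨ β b = 1 by omega) with h2 | h2 <;>
        rw [h1, h2] at hb
        · have := le_of_dvd_of_pos hb (by simpa using hlt)
          left; simp only [add_zero] at this; omega
        · have := nonneg_of_dvd_of_neg_lt hb (by simp only [add_zero]; omega)
          simp only [add_zero] at this
          exact Or.inr ⟨b, rfl, h2, by omega, fun _ => by omega⟩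
        · have := le_of_dvd_of_pos hb (by simp only [add_zero]; omega)
          left; simp only [add_zero] at this; omega
        · have := nonneg_of_dvd_of_neg_lt hb (by omega)
          exact Or.inr ⟨b, rfl, h2, by omega, fun h => by omega⟩
      · have hβk : β k ≤ β (k + 1) := hβ (by omega)
        have hαk : α k ≤ α (k + 1) := hα (by omega)
        have h2 : β (k + 1) = 1 := by omega
        have hgk := hg k
        rcases (show α (k + 1) = 0 ∨ α (k + 1) = 1 by omega) with h1 | h1 <;> rw [h1, h2] at hb
        · have := hk3 (by omega)
          have := nonneg_of_dvd_of_neg_lt hb (by simp only [add_zero]; omega)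
          simp only [add_zero] at this
          exact Or.inr ⟨k + 1, rfl, h2, by omega, fun _ => by omega⟩
        · have := nonneg_of_dvd_of_neg_lt hb (by omega)
          exact Or.inr ⟨k + 1, rfl, h2, by omega, fun h => by omega⟩
  rcases key b hab hm with h | ⟨_, _, _, h, _⟩
  exacts [h.le, h]

theorem mul_nonneg_of_aligned {q : ℤ} {g h : ℕ → ℤ} {α β : ℕ → ℕ}
    (hg : ∀ k, g k ≤ g (k + 1) ∧ g (k + 1) < g k + q)
    (hh : ∀ k, h k ≤ h (k + 1) ∧ h (k + 1) < h k + q)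
    (hα : Monotone α) (hβ : Monotone β) (hα1 : ∀ k, α k ≤ 1) (hβ1 : ∀ k, β k ≤ 1)
    {a b : ℕ} (hab : a ≤ b) (hm : ∀ k, a ≤ k → k < b → q ∣ g (k + α k) - h (k + β k)) :
    0 ≤ (g a - h a) * (g b - h b) :=
  sub_mul_sub_nonneg (le_of_lt_of_aligned hg hh hα hβ hα1 hβ1 hab hm)
    (le_of_lt_of_aligned hh hg hβ hα hβ1 hα1 hab fun k h1 h2 => by
      rw [← dvd_neg, neg_sub]; exact hm k h1 h2)

/-- In the binary case the sign of `g - h` is also constant along a run of symbols aligned with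
offset two: the parity of `g (k + 2) - h k` determines the sign at `k`, `k + 1` and `k + 2`. -/
theorem mul_nonneg_of_offset_two {g h : ℕ → ℤ}
    (hg : ∀ k, g k ≤ g (k + 1) ∧ g (k + 1) < g k + 2)
    (hh : ∀ k, h k ≤ h (k + 1) ∧ h (k + 1) < h k + 2)
    {a b : ℕ} (hab : a ≤ b) (hm : ∀ k, a ≤ k → k < b → (2 : ℤ) ∣ g (k + 2) - h k) :
    0 ≤ (g (a + 1) - h (a + 1)) * (g (b + 1) - h (b + 1)) := by
  rcases hab.eq_or_lt with rfl | hab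
  · exact mul_self_nonneg _
  have key : ∀ c, a + 1 ≤ c → c ≤ b →
      (h (a + 1) < g (a + 1) → h (c - 1) + 2 ≤ g (c + 1)) ∧
      (g (a + 1) < h (a + 1) → g (c + 1) ≤ h (c - 1)) := by
    intro c hc
    induction c, hc using Nat.le_induction with
    | base =>
      intro hcb
      have h1 := hm a le_rfl hab
      have h2 := hg (a + 1)
      have h3 := hh a
      simp only [add_tsub_cancel_right, add_assoc, one_add_one_eq_two] at *
      omega
    | succ c hc ih =>
      intro hcb
      have h0 := ih (by omega)
      obtain ⟨c, rfl⟩ : ∃ c', c = c' + 1 := ⟨c - 1, by omega⟩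
      have h1 := hm (c + 1) (by omega) (by omega)
      have h2 := hg (c + 1 + 1)
      have h3 := hh c
      simp only [add_tsub_cancel_right, add_assoc] at *
      norm_num at *
      omega
  obtain ⟨b, rfl⟩ : ∃ b', b = b' + 1 := ⟨b - 1, by omega⟩
  have h1 := key (b + 1) (by omega) le_rfl
  have h2 := hh b
  have h3 := hh (b + 1)
  simp only [add_tsub_cancel_right] at h1
  apply sub_mul_sub_nonneg <;> intro h <;> [have := h1.1 h; have := h1.2 h] <;> omega

theorem exists_threshold {σ : ℕ → ℕ} (hσ : Monotone σ) (c N : ℕ) :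
    ∃ p ≤ N, ∀ k < N, k < p ↔ σ k < c := by
  induction N with
  | zero => exact ⟨0, le_rfl, by simp⟩
  | succ N ih =>
    obtain ⟨p, hp, h⟩ := ih
    by_cases hN : σ N < c
    · refine ⟨N + 1, le_rfl, fun k hk => ?_⟩
      have : σ k ≤ σ N := hσ (by omega)
      omega
    · refine ⟨p, by omega, fun k hk => ?_⟩
      rcases (show k < N ∨ k = N by omega) with h' | rfl
      · exact h k h'
      · omega

/-- Two binary sequences from each of which two symbols are deleted: cutting once behind every
mismatched symbol, and at two further places, leaves blocks on which `g - h` has constant sign. The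
further cuts are made where the number `α + β` of deletions reaches `2` and where it reaches `3`. -/
theorem exists_cuts_of_two_deletions {g h : ℕ → ℤ} {α β : ℕ → ℕ} {n : ℕ} {M : Finset ℕ}
    (hg : ∀ k, g k ≤ g (k + 1) ∧ g (k + 1) < g k + 2)
    (hh : ∀ k, h k ≤ h (k + 1) ∧ h (k + 1) < h k + 2)
    (hα : Monotone α) (hβ : Monotone β) (hα2 : ∀ k, α k ≤ 2) (hβ2 : ∀ k, β k ≤ 2)
    (hm : ∀ k, k + 2 < n → k ∉ M → (2 : ℤ) ∣ g (k + α k) - h (k + β k)) :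
    ∃ E : Finset ℕ, E.card ≤ M.card + 2 ∧ ∀ a b, a < b → b < n →
      (∀ c ∈ E, c < a ∨ b ≤ c) → 0 ≤ (g a - h a) * (g b - h b) := by
  have hσ : Monotone fun k => α k + β k := hα.add hβ
  obtain ⟨p, hpN, hp⟩ := exists_threshold hσ 2 (n - 2)
  obtain ⟨p', -, hp'⟩ := exists_threshold hσ 3 (n - 2)
  refine ⟨insert p (insert p' (M.image fun k => if k < p then k else k + 1)), ?_, ?_⟩
  · have h1 := Finset.card_insert_le p (insert p' (M.image fun k => if k < p then k else k + 1))
    have h2 := Finset.card_insert_le p' (M.image fun k => if k < p then k else k + 1)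
    have h3 : (M.image fun k => if k < p then k else k + 1).card ≤ M.card := Finset.card_image_le
    omega
  intro a b hab hbn hE
  simp only [Finset.mem_insert, Finset.mem_image, forall_eq_or_imp, forall_exists_index, and_imp,
    forall_apply_eq_imp_iff₂] at hE
  obtain ⟨hE1, hE2, hE3⟩ := hE
  rcases hE1 with hpa | hbp
  · -- To the right of the first cut, symbol `k` controls the step from `k + 1` to `k + 2`.
    have hM : ∀ k, a ≤ k + 1 → k + 1 < b → (2 : ℤ) ∣ g (k + α k) - h (k + β k) := by
      intro k h1 h2
      refine hm k (by omega) fun hk => ?_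
      have := hE3 k hk
      rw [if_neg (by omega)] at this
      omega
    -- Deletions in front of the block on both sides only shift it.
    have shifted : (∀ k, a ≤ k + 1 → k + 1 < b → 1 ≤ α k ∧ 1 ≤ β k) →
        0 ≤ (g a - h a) * (g b - h b) := by
      intro h1
      refine mul_nonneg_of_aligned (q := 2) (α := fun k => α (k - 1) - 1)
        (β := fun k => β (k - 1) - 1) hg hh ?_ ?_ ?_ ?_ hab.le ?_
      · intro i j hij
        exact Nat.sub_le_sub_right (hα (Nat.sub_le_sub_right hij 1)) 1
      · intro i j hij
        exact Nat.sub_le_sub_right (hβ (Nat.sub_le_sub_right hij 1)) 1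
      · intro k; have := hα2 (k - 1); omega
      · intro k; have := hβ2 (k - 1); omega
      · intro k hak hkb
        obtain ⟨k, rfl⟩ : ∃ k', k = k' + 1 := ⟨k - 1, by omega⟩
        have h2 := h1 k hak hkb
        simp only [add_tsub_cancel_right]
        rw [show k + 1 + (α k - 1) = k + α k by omega, show k + 1 + (β k - 1) = k + β k by omega]
        exact hM k hak hkb
    rcases hE2 with hpa' | hbp'
    · refine shifted fun k h1 h2 => ?_
      have := hp' k (by omega)
      have := hα2 k
      have := hβ2 k
      omega
    · have hsum : ∀ k, a ≤ k + 1 → k + 1 < b → α k + β k = 2 := by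
        intro k h1 h2
        have := hp k (by omega)
        have := hp' k (by omega)
        omega
      obtain ⟨a, rfl⟩ : ∃ a', a = a' + 1 := ⟨a - 1, by omega⟩
      obtain ⟨b, rfl⟩ : ∃ b', b = b' + 1 := ⟨b - 1, by omega⟩
      have hsum' : ∀ k, a ≤ k → k < b → α k = α a ∧ β k = β a := by
        intro k h1 h2
        have := hsum k (by omega) (by omega)
        have := hsum a (by omega) (by omega)
        have : α a ≤ α k := hα h1
        have : β a ≤ β k := hβ h1
        omega
      have ha := hsum a (by omega) (by omega)
      rcases (show α a = 1 ∨ α a = 2 ∨ α a = 0 by omega) with h1 | h1 | h1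
      · refine shifted fun k h2 h3 => ?_
        have := hsum' k (by omega) (by omega)
        omega
      · refine mul_nonneg_of_offset_two hg hh (by omega) fun k h2 h3 => ?_
        have h4 := hM k (by omega) (by omega)
        rw [(hsum' k h2 h3).1, (hsum' k h2 h3).2, h1, show β a = 0 by omega] at h4
        exact h4
      · have := mul_nonneg_of_offset_two hh hg (a := a) (b := b) (by omega) fun k h2 h3 => by
          have h4 := hM k (by omega) (by omega)
          rw [(hsum' k h2 h3).1, (hsum' k h2 h3).2, h1, show β a = 2 by omega] at h4
          rw [← dvd_neg, neg_sub]
          exact h4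
        linarith
  · -- To the left of the first cut at most one symbol has been deleted altogether.
    have hle : ∀ k, k < b → α k + β k ≤ 1 := by
      intro k hk
      have := hp k (by omega)
      omega
    refine mul_nonneg_of_aligned (q := 2) (α := fun k => min (α k) 1) (β := fun k => min (β k) 1)
      hg hh (fun i j hij => min_le_min_right 1 (hα hij)) (fun i j hij => min_le_min_right 1 (hβ hij))
      (fun k => min_le_right _ _) (fun k => min_le_right _ _) hab.le fun k hak hkb => ?_
    have := hle k hkb
    rw [min_eq_left (by omega), min_eq_left (by omega)]
    refine hm k (by omega) fun hk => ?_
    have := hE3 k hk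
    rw [if_pos (by omega)] at this
    omega

/-! ### Moments of a sequence with few sign changes -/

theorem exists_signed_product {n : ℕ} (E : Finset ℕ) (δ : ℕ → ℤ)
    (hE : ∀ a b, a < b → b < n → (∀ c ∈ E, c < a ∨ b ≤ c) → 0 ≤ δ a * δ b) :
    ∃ F ⊆ E, ∃ ε : ℤ, (ε = 1 ∨ ε = -1) ∧
      ∀ i < n, 0 ≤ ε * (∏ c ∈ F, (2 * (i : ℤ) - 2 * c - 1)) * δ i := by
  -- A sequence without sign changes on a final segment has a fixed weak sign there.
  have hsign : ∀ (δ : ℕ → ℤ) (m : ℕ), (∀ a b, m ≤ a → a < b → b < n → 0 ≤ δ a * δ b) →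
      ∃ τ : ℤ, (τ = 1 ∨ τ = -1) ∧ ∀ i, m ≤ i → i < n → 0 ≤ τ * δ i := by
    intro δ m hm
    by_cases hneg : ∃ a, m ≤ a ∧ a < n ∧ δ a < 0
    · obtain ⟨a, ha, han, hδ⟩ := hneg
      refine ⟨-1, Or.inr rfl, fun i hi hin => ?_⟩
      rcases lt_trichotomy a i with h | rfl | h
      · nlinarith [hm a i ha h hin]
      · linarith
      · nlinarith [hm i a hi h han]
    · push Not at hneg
      exact ⟨1, Or.inl rfl, fun i hi hin => by linarith [hneg i hi hin]⟩
  induction E using Finset.induction_on_max generalizing δ with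
  | empty =>
    obtain ⟨τ, hτ, h⟩ := hsign δ 0 fun a b _ hab hb => hE a b hab hb (by simp)
    exact ⟨∅, le_rfl, τ, hτ, fun i hi => by simpa using h i (Nat.zero_le i) hi⟩
  | insert c E hc ih =>
    -- The sequence cut off behind `c` needs only the cuts below `c`.
    obtain ⟨F, hF, ε, hε, h⟩ := ih (fun i => if i ≤ c then δ i else 0) (by
      intro a b hab hb hcut
      by_cases hbc : b ≤ c
      · rw [if_pos hbc, if_pos (by omega)]
        refine hE a b hab hb fun d hd => ?_
        rcases Finset.mem_insert.mp hd with rfl | hd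
        · exact Or.inr hbc
        · exact hcut d hd
      · rw [if_neg hbc, mul_zero])
    obtain ⟨τ, hτ, hτδ⟩ := hsign δ (c + 1) fun a b ha hab hb => hE a b hab hb (by
      intro d hd
      rcases Finset.mem_insert.mp hd with rfl | hd
      · omega
      · have := hc d hd; omega)
    have hpos : ∀ i, c + 1 ≤ i → 0 < ∏ d ∈ F, (2 * (i : ℤ) - 2 * d - 1) := fun i hi =>
      Finset.prod_pos fun d hd => by have := hc d (hF hd); omega
    have hcF : c ∉ F := fun hcF => lt_irrefl c (hc c (hF hcF))
    by_cases hετ : ε = τ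
    · refine ⟨F, hF.trans (Finset.subset_insert _ _), ε, hε, fun i hi => ?_⟩
      by_cases hic : i ≤ c
      · simpa [hic] using h i hi
      · have := mul_nonneg (hpos i (by omega)).le (hτδ i (by omega) hi)
        rw [hετ]; linarith
    · refine ⟨insert c F, Finset.insert_subset_insert _ hF, -ε, by omega, fun i hi => ?_⟩
      rw [Finset.prod_insert hcF]
      by_cases hic : i ≤ c
      · have h1 := h i hi
        simp only [hic, if_true] at h1
        have h2 : (0 : ℤ) ≤ -(2 * (i : ℤ) - 2 * c - 1) := by omega
        have := mul_nonneg h2 h1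
        linarith
      · have h1 := mul_nonneg (hpos i (by omega)).le (hτδ i (by omega) hi)
        have h2 : (0 : ℤ) ≤ 2 * (i : ℤ) - 2 * c - 1 := by omega
        have := mul_nonneg h2 h1
        rw [show -ε = τ by omega]
        linarith

/-- A sequence that changes sign at most `m` times and whose moments of order `0, …, m` vanish is
zero: pair it with a polynomial of degree at most `m` that changes sign at the same places. -/
theorem eq_zero_of_moments {n m : ℕ} {E : Finset ℕ} (hm : E.card ≤ m) {δ : ℕ → ℤ}
    (hE : ∀ a b, a < b → b < n → (∀ c ∈ E, c < a ∨ b ≤ c) → 0 ≤ δ a * δ b)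
    (hδ : ∀ k ≤ m, ∑ i ∈ Finset.range n, ((i : ℤ) + 1) ^ k * δ i = 0) :
    ∀ i < n, δ i = 0 := by
  obtain ⟨F, hF, ε, hε, h⟩ := exists_signed_product E δ hE
  let P : Polynomial ℤ := ∏ c ∈ F, (2 * Polynomial.X - Polynomial.C (2 * (c : ℤ) + 3))
  have hdeg : P.natDegree < m + 1 := by
    have h1 : P.natDegree ≤ ∑ c ∈ F, 1 :=
      (Polynomial.natDegree_prod_le _ _).trans (Finset.sum_le_sum fun c _ => by compute_degree)
    have h2 := Finset.card_le_card hF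
    simp only [Finset.sum_const, smul_eq_mul, mul_one] at h1
    omega
  have heval : ∀ i : ℕ, P.eval ((i : ℤ) + 1) = ∏ c ∈ F, (2 * (i : ℤ) - 2 * c - 1) := by
    intro i
    simp only [P, Polynomial.eval_prod]
    refine Finset.prod_congr rfl fun c _ => ?_
    simp
    ring
  have hsum : ∑ i ∈ Finset.range n, ε * (∏ c ∈ F, (2 * (i : ℤ) - 2 * c - 1)) * δ i = 0 := by
    simp_rw [← heval, Polynomial.eval_eq_sum_range' hdeg, mul_assoc, Finset.sum_mul,
      ← Finset.mul_sum]
    rw [Finset.sum_comm]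
    rw [Finset.sum_eq_zero, mul_zero]
    intro k hk
    simp_rw [mul_assoc, ← Finset.mul_sum]
    rw [hδ k (by simpa [Nat.lt_succ_iff] using hk), mul_zero]
  intro i hi
  have h0 := (Finset.sum_eq_zero_iff_of_nonneg fun i hi => h i (Finset.mem_range.mp hi)).mp hsum i
    (Finset.mem_range.mpr hi)
  refine (mul_eq_zero.mp h0).resolve_left (mul_ne_zero (by omega) ?_)
  exact Finset.prod_ne_zero_iff.mpr fun c _ => by omega

/-! ### Codewords with a common erroneous word -/

theorem VT_accDiff_sub {q n : ℕ} (hq : 0 < q) (x y : Fin n → Fin q) (k : ℕ) :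
    VT k (accDiff x) - VT k (accDiff y) =
      ∑ i ∈ Finset.range n, ((i : ℤ) + 1) ^ k * (accSeq x i - accSeq y i) := by
  rw [Finset.sum_range, VT, VT, ← Finset.sum_sub_distrib]
  refine Finset.sum_congr rfl fun i _ => ?_
  rw [accDiff_eq_accSeq hq, accDiff_eq_accSeq hq]
  ring

theorem sum_Icc_one_pow (n k : ℕ) :
    ∑ i ∈ Finset.Icc 1 n, (i : ℤ) ^ k = ∑ i ∈ Finset.range n, ((i : ℤ) + 1) ^ k := by
  induction n with
  | zero => simp
  | succ n ih =>
    rw [Finset.sum_Icc_succ_top (by omega), ih, Finset.sum_range_succ]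
    push_cast
    rfl

/-- A moment of a sequence with entries of modulus at most `q (2s + 1)` stays below the modulus of
the code, because the first entry has modulus less than `q`. -/
theorem abs_moment_lt {q s n k : ℕ} (hn : 1 ≤ n) {δ : ℕ → ℤ}
    (h0 : |δ 0| < q) (hδ : ∀ i < n, |δ i| ≤ q * (2 * s + 1)) :
    |∑ i ∈ Finset.range n, ((i : ℤ) + 1) ^ k * δ i| < maxRes q s n k + 1 := by
  obtain ⟨n, rfl⟩ : ∃ m, n = m + 1 := ⟨n - 1, by omega⟩
  have h1 : |∑ i ∈ Finset.range n, (((i + 1 : ℕ) : ℤ) + 1) ^ k * δ (i + 1)| ≤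
      q * (2 * s + 1) * ∑ i ∈ Finset.range n, (((i + 1 : ℕ) : ℤ) + 1) ^ k := by
    rw [Finset.mul_sum]
    refine (Finset.abs_sum_le_sum_abs _ _).trans (Finset.sum_le_sum fun i hi => ?_)
    have hp : (0 : ℤ) ≤ (((i + 1 : ℕ) : ℤ) + 1) ^ k := by positivity
    rw [abs_mul, abs_of_nonneg hp, mul_comm]
    exact mul_le_mul_of_nonneg_right (hδ _ (by have := Finset.mem_range.mp hi; omega)) hp
  rw [maxRes, sum_Icc_one_pow, Finset.sum_range_succ', Finset.sum_range_succ', mul_add]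
  have h2 := abs_add_le (∑ i ∈ Finset.range n, (((i + 1 : ℕ) : ℤ) + 1) ^ k * δ (i + 1))
    ((((0 : ℕ) : ℤ) + 1) ^ k * δ 0)
  have h3 : (1 : ℤ) ≤ q := by have := abs_nonneg (δ 0); omega
  have h4 : (s : ℤ) ≤ s * q := le_mul_of_one_le_right (by positivity) h3
  simp only [Nat.cast_zero, zero_add, one_pow, one_mul, mul_one] at h2 ⊢
  linarith

/-- Two codewords coincide when their accumulative differential sequences stay close and change
their order at most `2s` times. -/
theorem eq_of_mem_code {q s n : ℕ} (hq : 0 < q) (hn : 1 ≤ n) {a : Fin (2 * s + 1) → ℤ}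
    {x y : Fin n → Fin q} (hx : x ∈ code q s n a) (hy : y ∈ code q s n a)
    (hbound : ∀ i, |accSeq x i - accSeq y i| ≤ q * (2 * s + 1))
    {E : Finset ℕ} (hcard : E.card ≤ 2 * s)
    (hE : ∀ a b, a < b → b < n → (∀ c ∈ E, c < a ∨ b ≤ c) →
      0 ≤ (accSeq x a - accSeq y a) * (accSeq x b - accSeq y b)) : x = y := by
  have h0 : |accSeq x 0 - accSeq y 0| < q := by
    have h1 := accSeq_zero hq x
    have h2 := accSeq_zero hq y
    rw [abs_lt]
    omega
  have hzero := eq_zero_of_moments hcard hE (by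
    intro k hk
    refine Int.eq_zero_of_abs_lt_dvd ?_ (abs_moment_lt hn h0 fun i _ => hbound i)
    rw [← VT_accDiff_sub hq]
    exact (((hy ⟨k, by omega⟩).trans (hx ⟨k, by omega⟩).symm)).dvd)
  funext i
  have h1 := (dvd_accSeq_sub y i).sub (dvd_accSeq_sub x i)
  have h2 : (((x i : ℕ) : ℤ)) ≡ ((y i : ℕ) : ℤ) [ZMOD q] := by
    have h3 := hzero i i.2
    rw [Int.modEq_iff_dvd, ← dvd_neg]
    convert h1 using 1
    linarith
  exact Fin.ext (Nat.ModEq.eq_of_lt_of_lt (Int.natCast_modEq_iff.mp h2) (x i).2 (y i).2)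

theorem dvd_accSeq_sub_of_errors {q n t s : ℕ} {x y : Fin n → Fin q} {v : List (Fin q)}
    (hx : Errors t s (List.ofFn x) v) (hy : Errors t s (List.ofFn y) v) :
    ∃ (α β : ℕ → ℕ) (M : Finset ℕ), Monotone α ∧ Monotone β ∧ (∀ k, α k ≤ t) ∧
      (∀ k, β k ≤ t) ∧ M.card ≤ 2 * s ∧
      ∀ k, k + t < n → k ∉ M → (q : ℤ) ∣ accSeq x (k + α k) - accSeq y (k + β k) := by
  obtain ⟨α, M, h1, h2, h3, h4⟩ := hx.exists_alignment
  obtain ⟨β, N, h5, h6, h7, h8⟩ := hy.exists_alignment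
  refine ⟨α, β, M ∪ N, h1, h5, h2, h6, (Finset.card_union_le _ _).trans (by omega), ?_⟩
  intro k hk hkMN
  simp only [Finset.mem_union, not_or] at hkMN
  have hlen := hx.length
  rw [List.length_ofFn] at hlen
  have hkv : k < v.length := by omega
  have h9 := dvd_accFrom_take_sub ((h4 k hkv hkMN.1).symm.trans (List.getElem?_eq_getElem hkv)) 0
  have h10 := dvd_accFrom_take_sub ((h8 k hkv hkMN.2).symm.trans (List.getElem?_eq_getElem hkv)) 0
  have h11 := h9.sub h10
  simpa [accSeq] using h11

theorem abs_accSeq_sub_le_of_errors {q n t s : ℕ} (hq : 0 < q) {x y : Fin n → Fin q}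
    {v : List (Fin q)} (hx : Errors t s (List.ofFn x) v) (hy : Errors t s (List.ofFn y) v)
    (i : ℕ) : |accSeq x i - accSeq y i| ≤ q * (2 * s + t) := by
  have h1 := hx.accFrom_take hq (i + 1)
  have h2 := hy.accFrom_take hq (i + 1)
  rw [abs_le, accSeq, accSeq]
  constructor <;> linarith

theorem isCorrecting_one {q s n : ℕ} (hq : 0 < q) (hn : 1 ≤ n) (a : Fin (2 * s + 1) → ℤ) :
    IsCorrecting 1 s (code q s n a) := by
  intro x hx y hy hxy
  refine Set.disjoint_left.mpr fun v hvx hvy => hxy ?_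
  obtain ⟨α, β, M, hα, hβ, hα1, hβ1, hM, hdvd⟩ := dvd_accSeq_sub_of_errors hvx hvy
  refine eq_of_mem_code hq hn hx hy
    (by exact_mod_cast abs_accSeq_sub_le_of_errors hq hvx hvy) hM fun a b hab hb hcut => ?_
  refine mul_nonneg_of_aligned (accSeq_step hq x) (accSeq_step hq y) hα hβ hα1 hβ1 hab.le
    fun k h1 h2 => hdvd k (by omega) fun hk => ?_
  have := hcut k hk
  omega

theorem isCorrecting_two {s n : ℕ} (hs : 1 ≤ s) (hn : 1 ≤ n) (a : Fin (2 * s + 1) → ℤ) :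
    IsCorrecting 2 (s - 1) (code 2 s n a) := by
  intro x hx y hy hxy
  refine Set.disjoint_left.mpr fun v hvx hvy => hxy ?_
  obtain ⟨α, β, M, hα, hβ, hα2, hβ2, hM, hdvd⟩ := dvd_accSeq_sub_of_errors hvx hvy
  obtain ⟨E, hcard, hE⟩ := exists_cuts_of_two_deletions (accSeq_step two_pos x)
    (accSeq_step two_pos y) hα hβ hα2 hβ2 hdvd
  refine eq_of_mem_code two_pos hn hx hy (fun i => ?_) (by omega : E.card ≤ 2 * s) hE
  have := abs_accSeq_sub_le_of_errors two_pos hvx hvy i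
  push_cast [Nat.cast_sub hs] at this ⊢
  linarith

/-! ### The size of the largest code -/

theorem maxRes_add_one_pos {q s n : ℕ} (hq : 0 < q) (hn : 1 ≤ n) (k : ℕ) :
    0 < maxRes q s n k + 1 := by
  have := abs_moment_lt (q := q) (s := s) (n := n) (k := k) (δ := 0) hn
    (by simpa using hq) (by intro i _; simp)
  simpa using this

theorem maxRes_add_one_le (q s n k : ℕ) :
    maxRes q s n k + 1 ≤ (q * (2 * s + 1) * n ^ (k + 1) : ℕ) := by
  have h1 : ∑ i ∈ Finset.Icc 1 n, (i : ℤ) ^ k ≤ (n : ℤ) ^ (k + 1) := by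
    refine (Finset.sum_le_card_nsmul _ _ ((n : ℤ) ^ k) fun i hi => ?_).trans (by
      simp [pow_succ, mul_comm])
    have := (Finset.mem_Icc.mp hi).2
    gcongr
  have h2 := mul_le_mul_of_nonneg_left h1 (by positivity : (0 : ℤ) ≤ q * (2 * s + 1))
  rw [maxRes]
  push_cast
  linarith

/-- By the pigeonhole principle some choice of residues gives a code containing at least the
average share of all words. -/
theorem exists_large_code {q s n : ℕ} (hq : 0 < q) (hn : 1 ≤ n) :
    ∃ a, Admissible q s n a ∧
      q ^ n ≤ (q * (2 * s + 1)) ^ (2 * s + 1) * n ^ ((s + 1) * (2 * s + 1)) *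
        (code q s n a).ncard := by
  classical
  let N : Fin (2 * s + 1) → ℤ := fun k => maxRes q s n k + 1
  have hN : ∀ k, 0 < N k := fun k => maxRes_add_one_pos hq hn k
  let T : Finset (Fin (2 * s + 1) → ℤ) := Fintype.piFinset fun k => Finset.Ico 0 (N k)
  let f : (Fin n → Fin q) → Fin (2 * s + 1) → ℤ := fun x k => VT k (accDiff x) % N k
  have hf : ∀ x ∈ (Finset.univ : Finset (Fin n → Fin q)), f x ∈ T := fun x _ =>
    Fintype.mem_piFinset.mpr fun k => Finset.mem_Ico.mpr
      ⟨Int.emod_nonneg _ (hN k).ne', Int.emod_lt_of_pos _ (hN k)⟩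
  have hT : T.Nonempty := ⟨0, Fintype.mem_piFinset.mpr fun k => Finset.mem_Ico.mpr ⟨le_rfl, hN k⟩⟩
  have hTcard : T.card ≤ (q * (2 * s + 1)) ^ (2 * s + 1) * n ^ ((s + 1) * (2 * s + 1)) := by
    have hexp : ∑ k : Fin (2 * s + 1), ((k : ℕ) + 1) = (s + 1) * (2 * s + 1) := by
      have h1 := Finset.sum_range_id_mul_two (2 * s + 2)
      rw [Finset.sum_range_succ', ← Finset.sum_range fun k => k + 1] at *
      simp only [add_zero] at h1
      rw [show 2 * s + 2 - 1 = 2 * s + 1 by omega] at h1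
      nlinarith
    calc T.card = ∏ k, (N k).toNat := by simp [T]
      _ ≤ ∏ k : Fin (2 * s + 1), q * (2 * s + 1) * n ^ ((k : ℕ) + 1) :=
        Finset.prod_le_prod' fun k _ => Int.toNat_le.mpr (maxRes_add_one_le q s n k)
      _ = _ := by
        rw [Finset.prod_mul_distrib, Finset.prod_pow_eq_pow_sum, hexp]
        simp
  obtain ⟨a, ha, hle⟩ : ∃ a ∈ T, q ^ n ≤ T.card * (code q s n a).ncard := by
    by_contra! hlt
    have hcode : ∀ a ∈ T, (Finset.univ.filter fun x => f x = a).card = (code q s n a).ncard := by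
      intro a ha
      rw [← Set.ncard_coe_finset]
      congr 1
      ext x
      have ha' := Fintype.mem_piFinset.mp ha
      simp only [Finset.coe_filter, Finset.mem_univ, true_and, Set.mem_ofPred_eq, code, f,
        funext_iff]
      refine forall_congr' fun k => ?_
      have := Finset.mem_Ico.mp (ha' k)
      rw [Int.ModEq, Int.emod_eq_of_lt this.1 this.2]
    have h1 := Finset.card_eq_sum_card_fiberwise hf
    rw [Finset.sum_congr rfl hcode] at h1
    simp only [Finset.card_univ, Fintype.card_fun, Fintype.card_fin] at h1
    have h2 : ∑ a ∈ T, T.card * (code q s n a).ncard < ∑ a ∈ T, q ^ n :=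
      Finset.sum_lt_sum_of_nonempty hT hlt
    rw [← Finset.mul_sum, ← h1, Finset.sum_const, smul_eq_mul] at h2
    exact lt_irrefl _ h2
  refine ⟨a, fun k => ?_, hle.trans (Nat.mul_le_mul_right _ hTcard)⟩
  have := Finset.mem_Ico.mp (Fintype.mem_piFinset.mp ha k)
  exact ⟨this.1, Int.lt_add_one_iff.mp this.2⟩

theorem exists_code_redundancy_le {q s n : ℕ} (hq : 0 < q) (hn : 1 ≤ n) :
    ∃ a, Admissible q s n a ∧ (code q s n a).Nonempty ∧
      redundancy (code q s n a) ≤ ((s : ℝ) + 1) * (2 * (s : ℝ) + 1) * Real.logb 2 (n : ℝ) +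
        (2 * (s : ℝ) + 1) * Real.logb 2 (q * (2 * (s : ℝ) + 1)) := by
  obtain ⟨a, ha, hle⟩ := exists_large_code (s := s) hq hn
  have hpos : 0 < (code q s n a).ncard := by
    have h1 : 0 < q ^ n := by positivity
    exact Nat.pos_of_mul_pos_left (h1.trans_le hle)
  refine ⟨a, ha, Set.nonempty_of_ncard_ne_zero hpos.ne', ?_⟩
  have hq' : (0 : ℝ) < q := by exact_mod_cast hq
  have hn' : (0 : ℝ) < n := by exact_mod_cast hn
  have hC : (0 : ℝ) < (code q s n a).ncard := by exact_mod_cast hpos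
  have h1 : ((q : ℝ)) ^ n ≤ (q * (2 * s + 1)) ^ (2 * s + 1) * n ^ ((s + 1) * (2 * s + 1)) *
      (code q s n a).ncard := by exact_mod_cast hle
  have h2 := Real.logb_le_logb_of_le one_lt_two (by positivity) h1
  rw [Real.logb_mul (by positivity) hC.ne', Real.logb_mul (by positivity) (by positivity),
    Real.logb_pow, Real.logb_pow, Real.logb_pow] at h2
  push_cast at h2
  rw [redundancy]
  linarith

end DelSub

theorem theorem3 (q s : ℕ) (hq : 2 ≤ q) :
    (∃ K : ℝ, ∀ n : ℕ, 1 ≤ n →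
      ∃ a : Fin (2 * s + 1) → ℤ, DelSub.Admissible q s n a ∧ (DelSub.code q s n a).Nonempty ∧
        DelSub.redundancy (DelSub.code q s n a) ≤
          ((s : ℝ) + 1) * (2 * (s : ℝ) + 1) * Real.logb 2 (n : ℝ) + K) ∧
    (∀ n : ℕ, 1 ≤ n → ∀ a : Fin (2 * s + 1) → ℤ, DelSub.Admissible q s n a →
      DelSub.IsCorrecting 1 s (DelSub.code q s n a)) ∧
    (q = 2 → 1 ≤ s → ∀ n : ℕ, 1 ≤ n → ∀ a : Fin (2 * s + 1) → ℤ, DelSub.Admissible q s n a →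
      DelSub.IsCorrecting 2 (s - 1) (DelSub.code q s n a)) := by
  have hq0 : 0 < q := by omega
  refine ⟨⟨_, fun n hn => DelSub.exists_code_redundancy_le hq0 hn⟩,
    fun n hn a _ => DelSub.isCorrecting_one hq0 hn a, ?_⟩
  rintro rfl hs n hn a -
  exact DelSub.isCorrecting_two hs hn a
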